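/- Consider prediction with $4$ experts and a geometric horizon: for $\delta\in(0,1)$ the number $T$ of steps satisfies $\Pr[T=t]=\delta(1-\delta)^t$ for $t=0,1,2,\dots$, independently of everything else. In each step $t$ the adversary gives every expert $i$ a gain $g_{it}\in\{0,1\}$, and the player, who knows only the gains of the earlier steps, follows an expert drawn from a distribution $A_t$ that may depend on those gains. Write $G_{it}=\sum_{s=1}^{t}g_{is}$. The (expected) regret that an adversary $\mathcal D$ inflicts on an algorithm $\mathcal A=(A_t)_t$ is $$R_\delta(\mathcal D,\mathcal A)=\sum_{T=0}^{\infty}\delta(1-\delta)^T\;\mathbb E_{g\sim\mathcal D}\Big[\max_{1\le i\le 4}G_{iT}-\sum_{t=1}^{T}\sum_{i=1}^{4}A_t(i)\,g_{it}\Big].$$ The comb adversary orders the experts before each step by decreasing cumulative gain (ties are broken by an arbitrary fixed rule, which may depend on the history), and then with probability $\frac12$ it gives gain $1$ to exactly the experts in positions $1$ and $3$, and with probability $\frac12$ to exactly the experts in positions $2$ and $4$. Let $\mathcal D$ be the comb adversary, and for every $\delta$ let $\mathcal A_\delta$ be any algorithm. Then the series defining $R_\delta(\mathcal D,\mathcal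 A_\delta)$ converges for every $\delta\in(0,1)$, and $$R_\delta(\mathcal D,\mathcal A_\delta)\sim\frac{\pi}{4}\,\frac{1}{\sqrt{2\delta}}\qquad\text{as }\delta\to0^+ .$$ -/

import Mathlib

open scoped Topology

noncomputable section

namespace Experts

/-- A binary gain vector for `k` experts, given as the set of experts that gain `1` in the step
(all the others gain `0`). -/
abbrev Gain (k : ℕ) := Finset (Fin k)

/-- The history of the first `t` steps. -/
abbrev History (k t : ℕ) := Fin t → Gain k

/-- An oblivious (binary) adversary: the distribution of the next gain vector as a function of the
gains of all the previous steps. -/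
abbrev Adversary (k : ℕ) := (t : ℕ) → History k t → PMF (Gain k)

/-- A player (algorithm): the distribution of the expert to be followed in the next step as a
function of the gains of all the previous steps. -/
abbrev Player (k : ℕ) := (t : ℕ) → History k t → PMF (Fin k)

/-- The gain of expert `i` in one step. -/
def gain {k : ℕ} (S : Gain k) (i : Fin k) : ℕ := if i ∈ S then 1 else 0

/-- The cumulative gain of expert `i` over a history. -/
def cumGain {k t : ℕ} (h : History k t) (i : Fin k) : ℕ := ∑ s : Fin t, gain (h s) i

/-- The first `s` steps of a history. -/
def past {k t : ℕ} (h : History k t) (s : Fin t) : History k s := Fin.take s s.is_lt.le h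

/-- The probability that the first `t` gain vectors drawn by the adversary `D` are `h`. -/
def histProb {k t : ℕ} (D : Adversary k) (h : History k t) : ℝ :=
  ∏ s : Fin t, (D s (past h s) (h s)).toReal

/-- The player's expected total gain when the adversary plays `h`. -/
def playerGain {k t : ℕ} (A : Player k) (h : History k t) : ℝ :=
  ∑ s : Fin t, ∑ i : Fin k, (A s (past h s) i).toReal * (gain (h s) i : ℝ)

/-- The player's expected regret when the adversary plays `h`: the cumulative gain of the best
expert in hindsight minus the player's expected total gain. -/
def regretOn {k t : ℕ} (A : Player k) (h : History k t) : ℝ :=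
  (⨆ i : Fin k, (cumGain h i : ℝ)) - playerGain A h

/-- The expected regret of `A` against `D` over exactly `T` steps. -/
def finiteRegret {k : ℕ} (T : ℕ) (D : Adversary k) (A : Player k) : ℝ :=
  ∑ h : History k T, histProb D h * regretOn A h

/-- The contribution of the horizon `T = t` to the regret with geometric horizon: before every
step the process ends with probability `δ`, independently of everything else, so that the horizon
is `t` with probability `δ (1 - δ) ^ t`. -/
def geomTerm {k : ℕ} (δ : ℝ) (D : Adversary k) (A : Player k) (t : ℕ) : ℝ :=
  δ * (1 - δ) ^ t * finiteRegret t D A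

/-- The expected regret of `A` against `D` with geometric horizon of parameter `δ`. -/
def geomRegret {k : ℕ} (δ : ℝ) (D : Adversary k) (A : Player k) : ℝ :=
  ∑' t : ℕ, geomTerm δ D A t

/-- A rule that, after every history, puts the experts in an order: `rank t h r` is the expert
in position `r`, where position `0` is the leader. -/
abbrev Ranking (k : ℕ) := (t : ℕ) → History k t → Equiv.Perm (Fin k)

/-- The rule orders the experts by decreasing cumulative gain (ties may be broken in any way). -/
def Ranking.IsSorted {k : ℕ} (rank : Ranking k) : Prop :=
  ∀ (t : ℕ) (h : History k t), Antitone fun r : Fin k => cumGain h (rank t h r)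

/-- The two teams of the comb: counting positions from `1`, the experts in the odd positions
`1, 3, 5, …` (`b = true`) and those in the even positions `2, 4, 6, …` (`b = false`). -/
def combTeam {k : ℕ} (σ : Equiv.Perm (Fin k)) (b : Bool) : Gain k :=
  Finset.univ.filter fun i => decide (Odd ((σ.symm i : ℕ) + 1)) = b

/-- The comb adversary: in every step one of the two teams, chosen by a fair coin, advances. -/
def comb {k : ℕ} (rank : Ranking k) : Adversary k := fun t h =>
  (PMF.uniformOfFintype Bool).map (combTeam (rank t h))

end Experts

end

namespace Experts

/-! Starting from equal gains, the comb keeps the sorted gains in the shape `n + a + d, n + a, n +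
d, n`, so the process is a Markov chain on pairs `d ≤ a`. The two teams are complementary, so every
player earns 1/2 per step on average, while the maximum rises by 1 or by the indicator of `d = 0`.
Hence the regret over `T` steps is half the expected number of ties for the lead before it
(`finiteRegret_comb`), whatever the player does, and the geometric horizon turns this into a
discounted count of ties.

That count is the value at `(0, 0)` of the bounded solution of the first-step equations. With
discount `1 / cosh θ`, the solution for fixed `a` is `coth θ * (exp (-dθ) + c a * cosh (dθ))`.
Matching across `d = a` makes `c a / cosh (aθ)` telescope into a series (`tieValue_eq`). The regret
is therefore `(1 + R) / (2 sinh θ)`, where `R` is a Riemann-Stieltjes sum for `∫ exp (-x) / cosh x ^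
2` over `[0, ∞)`, which is `π / 2 - 1`. As `δ → 0`, `sinh θ ∼ √(2δ)`. -/

/-! ### Expectations over histories, and one step of the comb -/

/-- The expectation of a function of the first `t` gain vectors drawn by the adversary `D`. -/
noncomputable def expect {k : ℕ} (D : Adversary k) (t : ℕ) (φ : History k t → ℝ) : ℝ :=
  ∑ h : History k t, histProb D h * φ h

/-- The history `h` followed by one more step with gain vector `S`. -/
def extend {k t : ℕ} (h : History k t) (S : Gain k) : History k (t + 1) :=
  Fin.snoc (α := fun _ => Gain k) h S

lemma extend_castSucc {k t : ℕ} (h : History k t) (S : Gain k) (s : Fin t) :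
    extend h S s.castSucc = h s := by
  simp [extend]

lemma extend_last {k t : ℕ} (h : History k t) (S : Gain k) :
    extend h S (Fin.last t) = S := by
  simp [extend]

lemma past_extend_castSucc {k t : ℕ} (h : History k t) (S : Gain k) (s : Fin t) :
    past (extend h S) s.castSucc = past h s := by
  funext r
  exact extend_castSucc h S (Fin.castLE s.is_lt.le r)

lemma past_extend_last {k t : ℕ} (h : History k t) (S : Gain k) :
    past (extend h S) (Fin.last t) = h := by
  funext r
  exact extend_castSucc h S r

lemma cumGain_extend {k t : ℕ} (h : History k t) (S : Gain k) (i : Fin k) :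
    cumGain (extend h S) i = cumGain h i + gain S i := by
  simp only [cumGain, Fin.sum_univ_castSucc, extend_castSucc, extend_last]

lemma histProb_extend {k t : ℕ} (D : Adversary k) (h : History k t) (S : Gain k) :
    histProb D (extend h S) = histProb D h * (D t h S).toReal := by
  rw [histProb, Fin.prod_univ_castSucc, extend_last, past_extend_last]
  congr 1
  refine Finset.prod_congr rfl fun s _ => ?_
  rw [extend_castSucc, past_extend_castSucc]
  rfl

lemma playerGain_extend {k t : ℕ} (A : Player k) (h : History k t) (S : Gain k) :
    playerGain A (extend h S) =
      playerGain A h + ∑ i : Fin k, (A t h i).toReal * (gain S i : ℝ) := by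
  rw [playerGain, Fin.sum_univ_castSucc, extend_last, past_extend_last]
  congr 1
  refine Finset.sum_congr rfl fun s _ => ?_
  rw [extend_castSucc, past_extend_castSucc]
  rfl

lemma expect_zero {k : ℕ} (D : Adversary k) (φ : History k 0 → ℝ) :
    expect D 0 φ = φ default := by
  simp only [expect, histProb, Finset.univ_unique, Finset.univ_eq_empty, Finset.prod_empty,
    one_mul, Finset.sum_singleton]
  exact congrArg φ (Subsingleton.elim _ _)

lemma sum_history_succ {k t : ℕ} (f : History k (t + 1) → ℝ) :
    ∑ h, f h = ∑ h : History k t, ∑ S : Gain k, f (extend h S) := by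
  rw [← Equiv.sum_comp (Fin.snocEquiv fun _ : Fin (t + 1) => Gain k) f, Fintype.sum_prod_type,
    Finset.sum_comm]
  rfl

lemma expect_succ {k : ℕ} (D : Adversary k) (t : ℕ) (φ : History k (t + 1) → ℝ) :
    expect D (t + 1) φ =
      expect D t fun h => ∑ S : Gain k, (D t h S).toReal * φ (extend h S) := by
  simp only [expect, sum_history_succ, histProb_extend, Finset.mul_sum, mul_assoc]

lemma expect_congr {k t : ℕ} {D : Adversary k} {φ ψ : History k t → ℝ}
    (h : ∀ h, histProb D h ≠ 0 → φ h = ψ h) : expect D t φ = expect D t ψ := by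
  refine Finset.sum_congr rfl fun x _ => ?_
  by_cases hx : histProb D x = 0
  · simp [hx]
  · rw [h x hx]

lemma expect_add {k t : ℕ} (D : Adversary k) (φ ψ : History k t → ℝ) :
    expect D t (fun h => φ h + ψ h) = expect D t φ + expect D t ψ := by
  simp only [expect, mul_add, Finset.sum_add_distrib]

lemma expect_const_mul {k t : ℕ} (D : Adversary k) (c : ℝ) (φ : History k t → ℝ) :
    expect D t (fun h => c * φ h) = c * expect D t φ := by
  simp only [expect, Finset.mul_sum]
  exact Finset.sum_congr rfl fun _ _ => by ring

lemma histProb_nonneg {k t : ℕ} (D : Adversary k) (h : History k t) : 0 ≤ histProb D h :=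
  Finset.prod_nonneg fun _ _ => ENNReal.toReal_nonneg

lemma expect_mono {k t : ℕ} (D : Adversary k) {φ ψ : History k t → ℝ} (h : ∀ h, φ h ≤ ψ h) :
    expect D t φ ≤ expect D t ψ :=
  Finset.sum_le_sum fun x _ => mul_le_mul_of_nonneg_left (h x) (histProb_nonneg D x)

lemma _root_.PMF.sum_toReal {α : Type*} [Fintype α] (p : PMF α) :
    ∑ a, (p a).toReal = 1 := by
  rw [← ENNReal.toReal_sum fun a _ => p.apply_ne_top a, ← tsum_fintype (L := .unconditional _),
    p.tsum_coe, ENNReal.toReal_one]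

lemma expect_const {k : ℕ} (D : Adversary k) (t : ℕ) (c : ℝ) : expect D t (fun _ => c) = c := by
  induction t with
  | zero => rw [expect_zero]
  | succ t ih => rw [expect_succ]; simpa only [← Finset.sum_mul, PMF.sum_toReal, one_mul] using ih

lemma comb_apply_toReal {k : ℕ} (rank : Ranking k) (t : ℕ) (h : History k t) (S : Gain k) :
    (comb rank t h S).toReal =
      (if S = combTeam (rank t h) true then 1 / 2 else 0) +
        (if S = combTeam (rank t h) false then 1 / 2 else 0) := by
  classical
  rw [comb, PMF.map_apply, tsum_fintype, Fintype.sum_bool, ENNReal.toReal_add]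
  · congr 1 <;> split_ifs <;> simp
  · split_ifs <;> simp
  · split_ifs <;> simp

lemma expect_comb_succ {k : ℕ} (rank : Ranking k) (t : ℕ) (φ : History k (t + 1) → ℝ) :
    expect (comb rank) (t + 1) φ = expect (comb rank) t fun h =>
      (φ (extend h (combTeam (rank t h) true)) + φ (extend h (combTeam (rank t h) false))) / 2 := by
  rw [expect_succ]
  congr 1
  funext h
  simp only [comb_apply_toReal, add_mul, ite_mul, zero_mul, Finset.sum_add_distrib,
    Finset.sum_ite_eq', Finset.mem_univ, if_true]
  ring

lemma exists_eq_extend_of_histProb_ne_zero {k t : ℕ} (rank : Ranking k) (h : History k (t + 1))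
    (hh : histProb (comb rank) h ≠ 0) :
    ∃ (g : History k t) (b : Bool), histProb (comb rank) g ≠ 0 ∧
      h = extend g (combTeam (rank t g) b) := by
  have e : h = extend (Fin.init h) (h (Fin.last t)) := (Fin.snoc_init_self h).symm
  rw [e, histProb_extend, comb_apply_toReal] at hh
  obtain ⟨h1, h2⟩ := mul_ne_zero_iff.1 hh
  by_cases ht : h (Fin.last t) = combTeam (rank t (Fin.init h)) true
  · exact ⟨_, true, h1, ht ▸ e⟩
  · by_cases hf : h (Fin.last t) = combTeam (rank t (Fin.init h)) false
    · exact ⟨_, false, h1, hf ▸ e⟩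
    · simp [ht, hf] at h2

lemma gain_combTeam {k : ℕ} (σ : Equiv.Perm (Fin k)) (b : Bool) (r : Fin k) :
    gain (combTeam σ b) (σ r) = if decide (Odd ((r : ℕ) + 1)) = b then 1 else 0 := by
  simp [gain, combTeam]

lemma gain_combTeam_add {k : ℕ} (σ : Equiv.Perm (Fin k)) (i : Fin k) :
    gain (combTeam σ true) i + gain (combTeam σ false) i = 1 := by
  obtain ⟨r, rfl⟩ := σ.surjective i
  rw [gain_combTeam, gain_combTeam]
  cases decide (Odd ((r : ℕ) + 1)) <;> simp

/-- Against the comb, every player gains `1 / 2` per step on average. -/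
lemma playerGain_extend_comb_average {k t : ℕ} (σ : Equiv.Perm (Fin k)) (A : Player k)
    (h : History k t) :
    (playerGain A (extend h (combTeam σ true)) + playerGain A (extend h (combTeam σ false))) / 2 =
      playerGain A h + 1 / 2 := by
  have key : ∑ i : Fin k, (A t h i).toReal * (gain (combTeam σ true) i : ℝ) +
      ∑ i : Fin k, (A t h i).toReal * (gain (combTeam σ false) i : ℝ) = 1 := by
    rw [← Finset.sum_add_distrib, ← (A t h).sum_toReal]
    refine Finset.sum_congr rfl fun i _ => ?_
    rw [← mul_add, ← Nat.cast_add, gain_combTeam_add, Nat.cast_one, mul_one]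
  rw [playerGain_extend, playerGain_extend]
  linarith

/-! ### The two-parameter profile of the sorted gains -/

/-- Gains of four experts which in decreasing order are `n + a + d`, `n + a`, `n + d`, `n`. -/
def HasProfile (x : Fin 4 → ℕ) (n d a : ℕ) : Prop :=
  d ≤ a ∧ ∃ σ : Equiv.Perm (Fin 4),
    x (σ 0) = n + a + d ∧ x (σ 1) = n + a ∧ x (σ 2) = n + d ∧ x (σ 3) = n

/-- All sorting permutations list the same values, so tie-breaking is irrelevant. -/
lemma HasProfile.of_sorted {x : Fin 4 → ℕ} {n d a : ℕ} (hx : HasProfile x n d a)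
    {τ : Equiv.Perm (Fin 4)} (hτ : Antitone fun r => x (τ r)) :
    x (τ 0) = n + a + d ∧ x (τ 1) = n + a ∧ x (τ 2) = n + d ∧ x (τ 3) = n := by
  obtain ⟨hda, σ, h0, h1, h2, h3⟩ := hx
  have hσ : Antitone (x ∘ σ) := by
    rw [Fin.antitone_iff_succ_le]
    intro i
    fin_cases i <;> simp [h0, h1, h2, h3, hda]
  have e := Tuple.unique_antitone hσ (τ := τ) hτ
  have := congr_fun e
  simp only [Function.comp_apply] at this
  simp [← this, h0, h1, h2, h3]

lemma HasProfile.iSup_eq {x : Fin 4 → ℕ} {n d a : ℕ} (hx : HasProfile x n d a) :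
    ⨆ i, (x i : ℝ) = n + a + d := by
  obtain ⟨hda, σ, h0, h1, h2, h3⟩ := hx
  have hda' : (d : ℝ) ≤ a := by exact_mod_cast hda
  apply le_antisymm
  · refine ciSup_le fun i => ?_
    obtain ⟨r, rfl⟩ := σ.surjective i
    have : x (σ r) ≤ n + a + d := by fin_cases r <;> (simp [h0, h1, h2, h3]; try omega)
    exact_mod_cast this
  · refine le_trans (le_of_eq ?_) (le_ciSup (Set.finite_range _).bddAbove (σ 0))
    rw [h0]
    push_cast
    ring

/-- The transition of the profile parameters `(d, a)` when the odd (`true`) or the even (`false`)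
team advances. -/
def combStep (d a : ℕ) : Bool → ℕ × ℕ
  | true => if d < a then (d + 1, a) else (a, a + 1)
  | false => if 0 < d then (d - 1, a) else if 0 < a then (1, a) else (0, 1)

/-- The increase of the leader's gain in one step of the comb. -/
def leaderGain (d : ℕ) : Bool → ℕ
  | true => 1
  | false => if d = 0 then 1 else 0

lemma HasProfile.step {x y : Fin 4 → ℕ} {n d a : ℕ} (hx : HasProfile x n d a)
    {τ : Equiv.Perm (Fin 4)} (hτ : Antitone fun r => x (τ r)) (b : Bool)
    (hy : ∀ i, y i = x i + gain (combTeam τ b) i) :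
    ∃ m, HasProfile y m (combStep d a b).1 (combStep d a b).2 ∧
      m + (combStep d a b).2 + (combStep d a b).1 = n + a + d + leaderGain d b := by
  obtain ⟨h0, h1, h2, h3⟩ := hx.of_sorted hτ
  have hda := hx.1
  have y0 := hy (τ 0)
  have y1 := hy (τ 1)
  have y2 := hy (τ 2)
  have y3 := hy (τ 3)
  rw [gain_combTeam] at y0 y1 y2 y3
  have o0 : Odd ((0 : Fin 4) + 1 : ℕ) := by decide
  have o1 : ¬ Odd ((1 : Fin 4) + 1 : ℕ) := by decide
  have o2 : Odd ((2 : Fin 4) + 1 : ℕ) := by decide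
  have o3 : ¬ Odd ((3 : Fin 4) + 1 : ℕ) := by decide
  simp only [o0, o1, o2, o3, decide_true, decide_false] at y0 y1 y2 y3
  cases b
  · simp only [reduceCtorEq, if_true, if_false] at y0 y1 y2 y3
    simp only [combStep, leaderGain]
    rcases Nat.eq_zero_or_pos d with rfl | hd
    · rcases Nat.eq_zero_or_pos a with rfl | ha
      -- The new order lists the advancing experts first: all four were tied, so the old positions 2
      -- and 4 now share the lead.
      · refine ⟨n, ⟨by simp, τ * Equiv.swap 0 3 , ?_⟩, by simp⟩
        have e1 : (Equiv.swap 0 3 : Equiv.Perm (Fin 4)) 1 = 1 := by decide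
        have e2 : (Equiv.swap 0 3 : Equiv.Perm (Fin 4)) 2 = 2 := by decide
        simp [e1, e2]
        omega
      -- Positions 1, 2 and positions 3, 4 were tied; the even team overtakes in both pairs.
      · refine ⟨n, ⟨by simp [ha]; omega, τ * (Equiv.swap 0 1 * Equiv.swap 2 3), ?_⟩,
          by simp [ha]⟩
        have e0 : (Equiv.swap 0 1 * Equiv.swap 2 3 : Equiv.Perm (Fin 4)) 0 = 1 := by decide
        have e1 : (Equiv.swap 0 1 * Equiv.swap 2 3 : Equiv.Perm (Fin 4)) 1 = 0 := by decide
        have e2 : (Equiv.swap 0 1 * Equiv.swap 2 3 : Equiv.Perm (Fin 4)) 2 = 3 := by decide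
        have e3 : (Equiv.swap 0 1 * Equiv.swap 2 3 : Equiv.Perm (Fin 4)) 3 = 2 := by decide
        simp only [Equiv.Perm.mul_apply τ, e0, e1, e2, e3, ha, if_true, lt_irrefl, if_false]
        omega
    · refine ⟨n + 1, ⟨by simp [hd]; omega, τ, ?_⟩, ?_⟩
      · simp only [hd, if_true]
        omega
      · simp only [hd, if_true, hd.ne', if_false]
        omega
  · simp only [reduceCtorEq, if_true, if_false] at y0 y1 y2 y3
    simp only [combStep, leaderGain]
    by_cases hd : d < a
    · refine ⟨n, ⟨by simp [hd], τ, ?_⟩, by simp [hd]; omega⟩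
      simp only [hd, if_true]
      omega
    -- Here `d = a`: positions 2 and 3 were tied and the third overtakes.
    · refine ⟨n, ⟨by simp [hd], τ * Equiv.swap 1 2, ?_⟩, by simp [hd]; omega⟩
      have e0 : (Equiv.swap 1 2 : Equiv.Perm (Fin 4)) 0 = 0 := by decide
      have e3 : (Equiv.swap 1 2 : Equiv.Perm (Fin 4)) 3 = 3 := by decide
      simp only [Equiv.Perm.mul_apply, e0, e3, hd, if_false, Equiv.swap_apply_left,
        Equiv.swap_apply_right]
      omega

lemma hasProfile_of_histProb_ne_zero {rank : Ranking 4} (hrank : rank.IsSorted) {t : ℕ}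
    (h : History 4 t) (hh : histProb (comb rank) h ≠ 0) :
    ∃ n d a, HasProfile (cumGain h) n d a := by
  induction t with
  | zero => exact ⟨0, 0, 0, le_rfl, 1, by simp [cumGain]⟩
  | succ t ih =>
    obtain ⟨g, b, hg, rfl⟩ := exists_eq_extend_of_histProb_ne_zero rank h hh
    obtain ⟨n, d, a, hp⟩ := ih g hg
    obtain ⟨m, hm, -⟩ := hp.step (hrank t g) b (fun i => cumGain_extend g _ i)
    exact ⟨m, _, _, hm⟩

/-- A function of the profile parameters `(d, a)`, as a function of the history. -/
noncomputable def ofProfile (rank : Ranking 4) (F : ℕ → ℕ → ℝ) {t : ℕ} (h : History 4 t) : ℝ :=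
  F (cumGain h (rank t h 0) - cumGain h (rank t h 1))
    (cumGain h (rank t h 0) - cumGain h (rank t h 2))

lemma HasProfile.ofProfile_eq {rank : Ranking 4} (hrank : rank.IsSorted) {t : ℕ}
    {h : History 4 t} {n d a : ℕ} (hp : HasProfile (cumGain h) n d a) (F : ℕ → ℕ → ℝ) :
    ofProfile rank F h = F d a := by
  obtain ⟨h0, h1, h2, -⟩ := hp.of_sorted (hrank t h)
  rw [ofProfile, h0, h1, h2]
  congr 1 <;> omega

/-- The average of `F` over the two transitions from `(d, a)`. -/
noncomputable def stepAverage (F : ℕ → ℕ → ℝ) (d a : ℕ) : ℝ :=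
  (F (combStep d a true).1 (combStep d a true).2 +
    F (combStep d a false).1 (combStep d a false).2) / 2

lemma expect_ofProfile_succ {rank : Ranking 4} (hrank : rank.IsSorted) (F : ℕ → ℕ → ℝ) (t : ℕ) :
    expect (comb rank) (t + 1) (ofProfile rank F) =
      expect (comb rank) t (ofProfile rank (stepAverage F)) := by
  rw [expect_comb_succ]
  refine expect_congr fun h hh => ?_
  obtain ⟨n, d, a, hp⟩ := hasProfile_of_histProb_ne_zero hrank h hh
  obtain ⟨m, hm, -⟩ := hp.step (hrank t h) true (fun i => cumGain_extend h _ i)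
  obtain ⟨m', hm', -⟩ := hp.step (hrank t h) false (fun i => cumGain_extend h _ i)
  rw [hp.ofProfile_eq hrank, hm.ofProfile_eq hrank, hm'.ofProfile_eq hrank, stepAverage]

/-! ### Regret as a discounted count of ties -/

/-- The indicator of a tie for the lead. -/
def tie (d _a : ℕ) : ℝ := if d = 0 then 1 else 0

/-- The probability that the two leading experts are tied after `t` steps of the comb. -/
noncomputable def tieProb (rank : Ranking 4) (t : ℕ) : ℝ :=
  expect (comb rank) t (ofProfile rank tie)

/-- On average the maximum gains `(1 + tie) / 2` and the player `1 / 2`; the difference is `tie /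
2`. -/
lemma finiteRegret_succ {rank : Ranking 4} (hrank : rank.IsSorted) (A : Player 4) (t : ℕ) :
    finiteRegret (t + 1) (comb rank) A =
      finiteRegret t (comb rank) A + 1 / 2 * tieProb rank t := by
  change expect _ _ _ = expect _ _ _ + _
  rw [expect_comb_succ, tieProb, ← expect_const_mul, ← expect_add]
  refine expect_congr fun h hh => ?_
  obtain ⟨n, d, a, hp⟩ := hasProfile_of_histProb_ne_zero hrank h hh
  obtain ⟨m, hm, em⟩ := hp.step (hrank t h) true (fun i => cumGain_extend h _ i)
  obtain ⟨m', hm', em'⟩ := hp.step (hrank t h) false (fun i => cumGain_extend h _ i)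
  have hA := playerGain_extend_comb_average (rank t h) A h
  rw [hp.ofProfile_eq hrank, regretOn, regretOn, regretOn, hp.iSup_eq, hm.iSup_eq, hm'.iSup_eq]
  have em1 := congrArg (Nat.cast (R := ℝ)) em
  have em2 := congrArg (Nat.cast (R := ℝ)) em'
  have el : ((leaderGain d true : ℕ) : ℝ) = 1 := by simp [leaderGain]
  have el' : ((leaderGain d false : ℕ) : ℝ) = tie d a := by simp [leaderGain, tie]
  push_cast at em1 em2
  rw [el] at em1
  rw [el'] at em2
  linarith

lemma finiteRegret_comb {rank : Ranking 4} (hrank : rank.IsSorted) (A : Player 4) (T : ℕ) :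
    finiteRegret T (comb rank) A = 1 / 2 * ∑ t ∈ Finset.range T, tieProb rank t := by
  induction T with
  | zero =>
    change expect _ _ _ = _
    simp [expect_zero, regretOn, cumGain, playerGain]
  | succ T ih => rw [finiteRegret_succ hrank, ih, Finset.sum_range_succ, mul_add]

lemma tieProb_nonneg (rank : Ranking 4) (t : ℕ) : 0 ≤ tieProb rank t := by
  rw [tieProb, ← expect_const (comb rank) t 0]
  exact expect_mono _ fun h => by rw [ofProfile, tie]; split_ifs <;> norm_num

lemma tieProb_le_one (rank : Ranking 4) (t : ℕ) : tieProb rank t ≤ 1 := by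
  rw [tieProb, ← expect_const (comb rank) t 1]
  exact expect_mono _ fun h => by rw [ofProfile, tie]; split_ifs <;> norm_num

/-- A bounded solution `F` of the discounted first-step equations computes the expected discounted
number of ties. -/
lemma hasSum_pow_mul_tieProb {rank : Ranking 4} (hrank : rank.IsSorted) {F : ℕ → ℕ → ℝ} {l C : ℝ}
    (hl0 : 0 ≤ l) (hl1 : l < 1) (hF0 : ∀ d a, d ≤ a → 0 ≤ F d a) (hFC : ∀ d a, d ≤ a → F d a ≤ C)
    (hF : ∀ d a, d ≤ a → F d a = tie d a + l * stepAverage F d a) :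
    HasSum (fun t => l ^ t * tieProb rank t) (F 0 0) := by
  rw [hasSum_iff_tendsto_nat_of_nonneg
    (fun t => mul_nonneg (pow_nonneg hl0 t) (tieProb_nonneg rank t))]
  set E : ℕ → ℝ := fun t => expect (comb rank) t (ofProfile rank F) with hE
  have hstep : ∀ t, E t = tieProb rank t + l * E (t + 1) := by
    intro t
    simp only [hE, tieProb]
    rw [expect_ofProfile_succ hrank, ← expect_const_mul, ← expect_add]
    refine expect_congr fun h hh => ?_
    obtain ⟨n, d, a, hp⟩ := hasProfile_of_histProb_ne_zero hrank h hh
    rw [hp.ofProfile_eq hrank, hp.ofProfile_eq hrank, hp.ofProfile_eq hrank, hF d a hp.1]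
  have hE0 : E 0 = F 0 0 := by
    simp only [hE, expect_zero]
    simp [ofProfile, cumGain]
  have hsum : ∀ N, ∑ t ∈ Finset.range N, l ^ t * tieProb rank t = F 0 0 - l ^ N * E N := by
    intro N
    induction N with
    | zero => simp [hE0]
    | succ N ih =>
      rw [Finset.sum_range_succ, ih, hstep N]
      ring
  have hbound : ∀ t, 0 ≤ E t ∧ E t ≤ C := by
    intro t
    -- The bounds on `F` hold only for `d ≤ a`. Other profiles have probability zero, so `F` can be
    -- compared with a function that is constant on `d ≤ a` and equal to `F` elsewhere.
    have hc : ∀ c,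
        expect (comb rank) t (ofProfile rank fun d a => if d ≤ a then c else F d a) = c := by
      intro c
      rw [← expect_const (comb rank) t c]
      refine expect_congr fun h hh => ?_
      obtain ⟨n, d, a, hp⟩ := hasProfile_of_histProb_ne_zero hrank h hh
      rw [hp.ofProfile_eq hrank, if_pos hp.1, expect_const]
    constructor
    · rw [← hc 0]
      refine expect_mono _ fun h => ?_
      rw [ofProfile, ofProfile]
      split_ifs with hd
      exacts [hF0 _ _ hd, le_rfl]
    · rw [← hc C]
      refine expect_mono _ fun h => ?_
      rw [ofProfile, ofProfile]
      split_ifs with hd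
      exacts [hFC _ _ hd, le_rfl]
  have hlim : Filter.Tendsto (fun N => l ^ N * E N) Filter.atTop (𝓝 0) := by
    refine squeeze_zero (fun N => mul_nonneg (pow_nonneg hl0 N) (hbound N).1)
      (fun N => mul_le_mul_of_nonneg_left (hbound N).2 (pow_nonneg hl0 N)) ?_
    simpa using (tendsto_pow_atTop_nhds_zero_of_lt_one hl0 hl1).mul_const C
  simp only [hsum]
  simpa using hlim.const_sub (F 0 0)

/-- Summation by parts: a tie at time `t` counts for every horizon beyond `t`, an event of
probability `(1 - δ) ^ (t + 1)`. -/
lemma hasSum_geomTerm_comb {rank : Ranking 4} (hrank : rank.IsSorted) (A : Player 4) {δ V : ℝ}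
    (hδ0 : 0 < δ) (hδ1 : δ < 1) (hV : HasSum (fun t => (1 - δ) ^ t * tieProb rank t) V) :
    HasSum (geomTerm δ (comb rank) A) (1 / 2 * ((1 - δ) * V)) := by
  set Q : ℕ → ℝ := fun N => ∑ t ∈ Finset.range N, tieProb rank t with hQ
  have hl0 : 0 ≤ 1 - δ := by linarith
  have hQ0 : ∀ N, 0 ≤ Q N := fun N => Finset.sum_nonneg fun t _ => tieProb_nonneg rank t
  have hQN : ∀ N, Q N ≤ N := fun N =>
    (Finset.sum_le_sum fun t _ => tieProb_le_one rank t).trans (by simp)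
  have hterm : ∀ t, geomTerm δ (comb rank) A t = δ * (1 - δ) ^ t * (1 / 2 * Q t) := fun t => by
    rw [geomTerm, finiteRegret_comb hrank]
  have hsum : ∀ N, ∑ t ∈ Finset.range N, geomTerm δ (comb rank) A t = 1 / 2 * ((1 - δ) *
      ∑ t ∈ Finset.range N, (1 - δ) ^ t * tieProb rank t - (N : ℝ) * (1 - δ) ^ N * (Q N / N)) := by
    intro N
    -- The boundary term is split this way because `Q N / N ≤ 1` and `N * (1 - δ) ^ N → 0`; at `N =
    -- 0` both sides vanish.
    have hcancel : ∀ N : ℕ, (N : ℝ) * (1 - δ) ^ N * (Q N / N) = (1 - δ) ^ N * Q N := by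
      intro N
      rcases Nat.eq_zero_or_pos N with rfl | hN
      · simp [hQ]
      · have : (N : ℝ) ≠ 0 := by positivity
        field_simp
    rw [hcancel]
    induction N with
    | zero => simp [hQ]
    | succ N ih =>
      have : Q (N + 1) = Q N + tieProb rank N := Finset.sum_range_succ _ _
      rw [Finset.sum_range_succ, Finset.sum_range_succ, ih, hterm, this]
      ring
  rw [hasSum_iff_tendsto_nat_of_nonneg]
  · simp only [hsum]
    have hlim : Filter.Tendsto (fun N : ℕ => (N : ℝ) * (1 - δ) ^ N * (Q N / N))
        Filter.atTop (𝓝 0) := by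
      refine squeeze_zero (fun N => ?_) (fun N => ?_)
        (tendsto_self_mul_const_pow_of_lt_one hl0 (by linarith))
      · exact mul_nonneg (by positivity) (div_nonneg (hQ0 N) N.cast_nonneg)
      · exact mul_le_of_le_one_right (by positivity) (div_le_one_of_le₀ (hQN N) N.cast_nonneg)
    simpa only [sub_zero] using
      ((hV.tendsto_sum_nat.const_mul (1 - δ)).sub hlim).const_mul (1 / 2)
  · intro t
    rw [hterm]
    have := hQ0 t
    positivity

/-! ### The integral of `exp (-x) / cosh x ^ 2` and its Riemann sums -/

section Analysis

open Real Filter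

/-- An antiderivative of `exp (-x) / cosh x ^ 2`. -/
noncomputable def primitive (x : ℝ) : ℝ := arctan (sinh x) + (cosh x)⁻¹

lemma hasDerivAt_primitive (x : ℝ) : HasDerivAt primitive (exp (-x) / cosh x ^ 2) x := by
  have h := ((hasDerivAt_sinh x).arctan).add ((hasDerivAt_cosh x).inv (cosh_pos x).ne')
  refine h.congr_deriv ?_
  have hc := (cosh_pos x).ne'
  rw [← cosh_sub_sinh, add_comm (1 : ℝ), ← cosh_sq]
  field_simp
  ring

lemma primitive_zero : primitive 0 = 1 := by simp [primitive]

lemma tendsto_primitive : Tendsto primitive atTop (𝓝 (π / 2)) := by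
  have h1 : Tendsto sinh atTop atTop := sinhOrderIso.tendsto_atTop
  have h2 : Tendsto cosh atTop atTop :=
    tendsto_atTop_mono (fun x => (sinh_lt_cosh x).le) h1
  unfold primitive
  simpa using ((tendsto_arctan_atTop.mono_right nhdsWithin_le_nhds).comp h1).add
    h2.inv_tendsto_atTop

lemma cosh_le_exp_sub_mul_cosh {x y : ℝ} (hxy : x ≤ y) : cosh y ≤ exp (y - x) * cosh x := by
  have h : cosh y = cosh (y - x) * cosh x + sinh (y - x) * sinh x := by
    rw [← cosh_add, sub_add_cancel]
  rw [h, ← cosh_add_sinh, add_mul]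
  have := mul_le_mul_of_nonneg_left (sinh_lt_cosh x).le (sinh_nonneg_iff.2 (sub_nonneg.2 hxy))
  linarith

lemma primitive_sub_bounds {x y : ℝ} (hx : 0 ≤ x) (hxy : x < y) :
    primitive y - primitive x ≤ exp (y - x) * ((exp (-x) - exp (-y)) / (cosh x * cosh y)) ∧
      (exp (-x) - exp (-y)) / (cosh x * cosh y) ≤
        exp (y - x) * (primitive y - primitive x) := by
  -- Cauchy's mean value theorem against `exp (-z)` leaves only `cosh z ^ 2` to compare with `cosh x
  -- * cosh y`; they agree up to a factor `exp (y - x)`.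
  obtain ⟨z, hz, e⟩ := exists_ratio_hasDerivAt_eq_ratio_slope primitive
    (fun z => exp (-z) / cosh z ^ 2) hxy
    (fun z _ => (hasDerivAt_primitive z).continuousAt.continuousWithinAt)
    (fun z _ => hasDerivAt_primitive z) (fun z => exp (-z)) (fun z => -exp (-z))
    (by fun_prop) (fun z _ => by simpa using (hasDerivAt_neg z).exp)
  have cx := cosh_pos x
  have cy := cosh_pos y
  have cz := cosh_pos z
  have hw : 0 ≤ exp (-x) - exp (-y) := sub_nonneg.2 (exp_le_exp.2 (by linarith))
  have hxz : cosh x ≤ cosh z := cosh_le_cosh.2 (abs_le_abs_of_nonneg hx hz.1.le)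
  have hzy : cosh z ≤ cosh y :=
    cosh_le_cosh.2 (abs_le_abs_of_nonneg (hx.trans hz.1.le) hz.2.le)
  have hyx := cosh_le_exp_sub_mul_cosh hxy.le
  have e' : primitive y - primitive x = (exp (-x) - exp (-y)) / cosh z ^ 2 := by
    have := (exp_pos (-z)).ne'
    field_simp at e ⊢
    linarith
  rw [e']
  constructor
  · rw [← mul_div_assoc, div_le_div_iff₀ (by positivity) (by positivity)]
    have : cosh x * cosh y ≤ exp (y - x) * cosh z ^ 2 := by
      calc cosh x * cosh y ≤ cosh x * (exp (y - x) * cosh x) := by gcongr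
        _ = exp (y - x) * cosh x ^ 2 := by ring
        _ ≤ exp (y - x) * cosh z ^ 2 := by gcongr
    nlinarith [mul_le_mul_of_nonneg_left this hw]
  · rw [← mul_div_assoc, div_le_div_iff₀ (by positivity) (by positivity)]
    have : cosh z ^ 2 ≤ exp (y - x) * (cosh x * cosh y) := by
      calc cosh z ^ 2 ≤ cosh y ^ 2 := by gcongr
        _ = cosh y * cosh y := sq _
        _ ≤ (exp (y - x) * cosh x) * cosh y := by gcongr
        _ = _ := by ring
    nlinarith [mul_le_mul_of_nonneg_left this hw]

/-- A Riemann-Stieltjes term for the integral of `exp (-x) / cosh x ^ 2` with mesh `θ`. -/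
noncomputable def riemannTerm (θ : ℝ) (j : ℕ) : ℝ :=
  (exp (-(j * θ)) - exp (-((j + 1) * θ))) / (cosh (j * θ) * cosh ((j + 1) * θ))

lemma riemannTerm_nonneg {θ : ℝ} (hθ : 0 < θ) (j : ℕ) : 0 ≤ riemannTerm θ j :=
  div_nonneg (sub_nonneg.2 (exp_le_exp.2 (by linarith))) (by positivity)

lemma riemannTerm_bounds {θ : ℝ} (hθ : 0 < θ) (j : ℕ) :
    primitive ((j + 1) * θ) - primitive (j * θ) ≤ exp θ * riemannTerm θ j ∧
      riemannTerm θ j ≤ exp θ * (primitive ((j + 1) * θ) - primitive (j * θ)) := by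
  have h := primitive_sub_bounds (x := j * θ) (y := (j + 1) * θ) (by positivity) (by linarith)
  rwa [show ((j : ℝ) + 1) * θ - j * θ = θ by ring] at h

lemma hasSum_primitive_sub {θ : ℝ} (hθ : 0 < θ) :
    HasSum (fun j : ℕ => primitive ((j + 1) * θ) - primitive (j * θ)) (π / 2 - 1) := by
  rw [hasSum_iff_tendsto_nat_of_nonneg]
  · have e : ∀ N : ℕ, ∑ j ∈ Finset.range N, (primitive ((j + 1) * θ) - primitive (j * θ)) =
        primitive (N * θ) - 1 := by
      intro N
      have := Finset.sum_range_sub (fun j : ℕ => primitive (j * θ)) N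
      simpa [primitive_zero] using this
    simp only [e]
    exact (tendsto_primitive.comp (tendsto_natCast_atTop_atTop.atTop_mul_const hθ)).sub_const 1
  · intro j
    have h1 := riemannTerm_nonneg hθ j
    have h2 := (riemannTerm_bounds hθ j).2
    exact nonneg_of_mul_nonneg_right (h1.trans h2) (exp_pos θ)

lemma summable_riemannTerm {θ : ℝ} (hθ : 0 < θ) : Summable (riemannTerm θ) :=
  Summable.of_nonneg_of_le (riemannTerm_nonneg hθ) (fun j => (riemannTerm_bounds hθ j).2)
    ((hasSum_primitive_sub hθ).summable.mul_left _)

/-- The tail, from the index `a` on, of the series of the Riemann terms. -/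
noncomputable def riemannTail (θ : ℝ) (a : ℕ) : ℝ := ∑' j, riemannTerm θ (j + a)

lemma riemannTail_nonneg {θ : ℝ} (hθ : 0 < θ) (a : ℕ) : 0 ≤ riemannTail θ a :=
  tsum_nonneg fun _ => riemannTerm_nonneg hθ _

lemma riemannTail_eq_add {θ : ℝ} (hθ : 0 < θ) (a : ℕ) :
    riemannTail θ a = riemannTerm θ a + riemannTail θ (a + 1) := by
  rw [riemannTail, ((summable_nat_add_iff a).2 (summable_riemannTerm hθ)).tsum_eq_zero_add,
    riemannTail, zero_add]
  congr 1
  exact tsum_congr fun j => by congr 1; ring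

lemma riemannTail_zero_bounds {θ : ℝ} (hθ : 0 < θ) :
    (π / 2 - 1) ≤ exp θ * riemannTail θ 0 ∧ riemannTail θ 0 ≤ exp θ * (π / 2 - 1) := by
  have h := (summable_riemannTerm hθ).hasSum
  exact ⟨hasSum_le (fun j => (riemannTerm_bounds hθ j).1) (hasSum_primitive_sub hθ)
      (h.mul_left _),
    hasSum_le (fun j => (riemannTerm_bounds hθ j).2) h ((hasSum_primitive_sub hθ).mul_left _)⟩

/-- Bounding both `cosh` factors below by `cosh (a * θ)` makes the numerators telescope. This decay
keeps `tieValue` bounded on `d ≤ a`. -/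
lemma riemannTail_le {θ : ℝ} (hθ : 0 < θ) (a : ℕ) :
    riemannTail θ a ≤ exp (-(a * θ)) / cosh (a * θ) ^ 2 := by
  refine Real.tsum_le_of_sum_range_le (fun _ => riemannTerm_nonneg hθ _) fun N => ?_
  have hterm : ∀ j : ℕ, riemannTerm θ (j + a) ≤
      (exp (-(((j : ℕ) + a : ℕ) * θ)) - exp (-(((j + 1 : ℕ) + a : ℕ) * θ))) /
        cosh (a * θ) ^ 2 := by
    intro j
    have e : (((j + 1 : ℕ) + a : ℕ) : ℝ) = ((j + a : ℕ) : ℝ) + 1 := by push_cast; ring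
    rw [riemannTerm, e, sq]
    have hj : (0 : ℝ) ≤ j * θ := by positivity
    have ha : (0 : ℝ) ≤ a * θ := by positivity
    refine div_le_div_of_nonneg_left (sub_nonneg.2 (exp_le_exp.2 (by linarith)))
      (by positivity) (mul_le_mul ?_ ?_ (cosh_pos _).le (cosh_pos _).le)
    all_goals
      refine cosh_le_cosh.2 (abs_le_abs_of_nonneg ha ?_)
      push_cast
      linarith
  refine (Finset.sum_le_sum fun j _ => hterm j).trans ?_
  rw [← Finset.sum_div, Finset.sum_range_sub' (fun j : ℕ => exp (-((j + a : ℕ) * θ)))]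
  gcongr
  simpa using (exp_pos _).le

/-! ### Explicit solution of the first-step equations -/

/-- The expected discounted number of ties when the comb is started at the profile parameters
`(d, a)` and the discount factor is `1 / cosh θ`. -/
noncomputable def tieValue (θ : ℝ) (d a : ℕ) : ℝ :=
  cosh θ / sinh θ * (exp (-(d * θ)) + riemannTail θ a * cosh (a * θ) * cosh (d * θ))

lemma tieValue_nonneg {θ : ℝ} (hθ : 0 < θ) (d a : ℕ) : 0 ≤ tieValue θ d a := by
  have h1 := riemannTail_nonneg hθ a
  have h2 := sinh_pos_iff.2 hθ
  unfold tieValue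
  positivity

lemma tieValue_le {θ : ℝ} (hθ : 0 < θ) {d a : ℕ} (hda : d ≤ a) :
    tieValue θ d a ≤ cosh θ / sinh θ * 2 := by
  have h2 := sinh_pos_iff.2 hθ
  have hd : (0 : ℝ) ≤ d * θ := by positivity
  have ha : (0 : ℝ) ≤ a * θ := by positivity
  have hda' : (d : ℝ) * θ ≤ a * θ := by gcongr
  have hc : cosh (d * θ) ≤ cosh (a * θ) := cosh_le_cosh.2 (abs_le_abs_of_nonneg hd hda')
  have e1 : exp (-(d * θ)) ≤ 1 := exp_le_one_iff.2 (by linarith)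
  have e2 : exp (-(a * θ)) ≤ 1 := exp_le_one_iff.2 (by linarith)
  have ht := riemannTail_nonneg hθ a
  have h3 : riemannTail θ a * cosh (a * θ) * cosh (d * θ) ≤ 1 := by
    calc riemannTail θ a * cosh (a * θ) * cosh (d * θ)
        ≤ riemannTail θ a * cosh (a * θ) * cosh (a * θ) := by gcongr
      _ = riemannTail θ a * cosh (a * θ) ^ 2 := by ring
      _ ≤ exp (-(a * θ)) := (le_div_iff₀ (by positivity)).1 (riemannTail_le hθ a)
      _ ≤ 1 := e2
  unfold tieValue
  gcongr
  linarith

lemma riemannTerm_mul {θ : ℝ} (j : ℕ) :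
    riemannTerm θ j * (cosh (j * θ) * cosh ((j + 1) * θ)) =
      exp (-(j * θ)) - exp (-((j + 1) * θ)) :=
  div_mul_cancel₀ _ (mul_pos (cosh_pos _) (cosh_pos _)).ne'

/-- On the boundary `d = a`, the value is the continuation of the solution inside. -/
lemma tieValue_self_succ {θ : ℝ} (hθ : 0 < θ) (a : ℕ) :
    tieValue θ a (a + 1) = tieValue θ (a + 1) a := by
  have h := riemannTerm_mul (θ := θ) a
  rw [tieValue, tieValue, riemannTail_eq_add hθ a]
  push_cast
  congr 1
  linear_combination -h

/-- For fixed `a`, both `exp (-dθ)` and `cosh (dθ)` are eigenfunctions of the two-neighbour average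
with eigenvalue `cosh θ`. -/
lemma tieValue_eq_average {θ : ℝ} (d a : ℕ) :
    tieValue θ (d + 1) a =
      (cosh θ)⁻¹ * ((tieValue θ (d + 2) a + tieValue θ d a) / 2) := by
  have hc := (cosh_pos θ).ne'
  have e1 : ((d + 2 : ℕ) : ℝ) * θ = (d + 1 : ℕ) * θ + θ := by push_cast; ring
  have e2 : (d : ℝ) * θ = (d + 1 : ℕ) * θ - θ := by push_cast; ring
  rw [tieValue, tieValue, tieValue, e1, e2]
  simp only [← cosh_sub_sinh (_ * θ), ← cosh_sub_sinh (_ * θ + θ), ← cosh_sub_sinh (_ * θ - θ),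
    cosh_add, cosh_sub, sinh_add, sinh_sub]
  field_simp
  ring

/-- The reflection at `d = 0` annihilates the `cosh` part, and the source term 1 fixes the prefactor
`coth θ` of the exponential. -/
lemma tieValue_zero_succ {θ : ℝ} (hθ : 0 < θ) (a : ℕ) :
    tieValue θ 0 a = 1 + (cosh θ)⁻¹ * tieValue θ 1 a := by
  have hc := (cosh_pos θ).ne'
  have hs := (sinh_pos_iff.2 hθ).ne'
  simp only [tieValue, Nat.cast_zero, Nat.cast_one, zero_mul, one_mul, neg_zero, exp_zero,
    cosh_zero, mul_one, ← cosh_sub_sinh θ]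
  field_simp
  ring

lemma tieValue_eq {θ : ℝ} (hθ : 0 < θ) (d a : ℕ) (hda : d ≤ a) :
    tieValue θ d a = tie d a + (cosh θ)⁻¹ * stepAverage (tieValue θ) d a := by
  rcases d with _ | d
  · rcases a with _ | a
    -- From `(0, 0)` both teams lead to `(0, 1)`, whose value equals that of the fictitious state
    -- `(1, 0)`.
    · have h := tieValue_self_succ hθ 0
      simp only [zero_add] at h
      simp [stepAverage, combStep, tie, h, tieValue_zero_succ hθ 0]
    · simp [stepAverage, combStep, tie, tieValue_zero_succ hθ (a + 1)]
  · rw [tieValue_eq_average]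
    rcases hda.lt_or_eq with h | rfl
    · simp [stepAverage, combStep, tie, h]
    · simp [stepAverage, combStep, tie, tieValue_self_succ hθ (d + 1)]

lemma hasSum_geomTerm_comb_of_cosh {rank : Ranking 4} (hrank : rank.IsSorted) (A : Player 4)
    {δ θ : ℝ} (hδ0 : 0 < δ) (hδ1 : δ < 1) (hθ : 0 < θ) (h : (cosh θ)⁻¹ = 1 - δ) :
    HasSum (geomTerm δ (comb rank) A) ((1 + riemannTail θ 0) / (2 * sinh θ)) := by
  have hV := hasSum_pow_mul_tieProb hrank (F := tieValue θ) (l := 1 - δ)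
    (C := cosh θ / sinh θ * 2) (by linarith) (by linarith) (fun d a _ => tieValue_nonneg hθ d a)
    (fun d a hda => tieValue_le hθ hda) (fun d a hda => h ▸ tieValue_eq hθ d a hda)
  convert hasSum_geomTerm_comb hrank A hδ0 hδ1 hV using 1
  have hc := (cosh_pos θ).ne'
  have hs := (sinh_pos_iff.2 hθ).ne'
  rw [← h, tieValue]
  simp
  field_simp

/-! ### The limit of vanishing `δ` -/

/-- The mesh that belongs to the discount factor `1 - δ`. -/
noncomputable def mesh (δ : ℝ) : ℝ := arsinh (√(δ * (2 - δ)) / (1 - δ))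

lemma mesh_pos {δ : ℝ} (hδ0 : 0 < δ) (hδ1 : δ < 1) : 0 < mesh δ :=
  arsinh_pos_iff.2 (div_pos (sqrt_pos.2 (mul_pos hδ0 (by linarith))) (by linarith))

lemma inv_cosh_mesh {δ : ℝ} (hδ0 : 0 < δ) (hδ1 : δ < 1) : (cosh (mesh δ))⁻¹ = 1 - δ := by
  have h1 : 0 < 1 - δ := by linarith
  have h : 1 + (√(δ * (2 - δ)) / (1 - δ)) ^ 2 = ((1 - δ)⁻¹) ^ 2 := by
    rw [div_pow, sq_sqrt (mul_nonneg hδ0.le (by linarith))]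
    field_simp
    ring
  rw [mesh, cosh_arsinh, h, sqrt_sq (by positivity), inv_inv]

lemma tendsto_mesh : Tendsto mesh (𝓝[>] 0) (𝓝[>] 0) := by
  refine tendsto_nhdsWithin_iff.2 ⟨?_, ?_⟩
  · have : ContinuousAt mesh 0 := by
      unfold mesh
      refine (continuous_arsinh.continuousAt).comp (ContinuousAt.div ?_ ?_ (by norm_num)) <;>
        fun_prop
    simpa [mesh] using this.tendsto.mono_left nhdsWithin_le_nhds
  · filter_upwards [Ioo_mem_nhdsGT (zero_lt_one' ℝ)] with δ hδ using mesh_pos hδ.1 hδ.2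

lemma tendsto_riemannTail_zero :
    Tendsto (fun θ => riemannTail θ 0) (𝓝[>] 0) (𝓝 (π / 2 - 1)) := by
  have hlow : Tendsto (fun θ : ℝ => exp (-θ) * (π / 2 - 1)) (𝓝[>] 0) (𝓝 (π / 2 - 1)) := by
    have : Continuous fun θ : ℝ => exp (-θ) * (π / 2 - 1) := by fun_prop
    simpa using (this.tendsto 0).mono_left nhdsWithin_le_nhds
  have hupp : Tendsto (fun θ : ℝ => exp θ * (π / 2 - 1)) (𝓝[>] 0) (𝓝 (π / 2 - 1)) := by
    have : Continuous fun θ : ℝ => exp θ * (π / 2 - 1) := by fun_prop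
    simpa using (this.tendsto 0).mono_left nhdsWithin_le_nhds
  refine tendsto_of_tendsto_of_tendsto_of_le_of_le' hlow hupp ?_ ?_
  · filter_upwards [self_mem_nhdsWithin] with θ hθ
    rw [exp_neg, inv_mul_le_iff₀ (exp_pos θ)]
    exact (riemannTail_zero_bounds hθ).1
  · filter_upwards [self_mem_nhdsWithin] with θ hθ using (riemannTail_zero_bounds hθ).2

lemma tendsto_sqrt_div_sinh_mesh :
    Tendsto (fun δ => √(2 * δ) / sinh (mesh δ)) (𝓝[>] 0) (𝓝 1) := by
  have h : Tendsto (fun δ : ℝ => √2 * (1 - δ) / √(2 - δ)) (𝓝[>] 0) (𝓝 1) := by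
    have : ContinuousAt (fun δ : ℝ => √2 * (1 - δ) / √(2 - δ)) 0 :=
      ContinuousAt.div (by fun_prop) (by fun_prop) (by norm_num)
    simpa using this.tendsto.mono_left nhdsWithin_le_nhds
  refine h.congr' ?_
  filter_upwards [Ioo_mem_nhdsGT (zero_lt_one' ℝ)] with δ hδ
  have h0 : √δ ≠ 0 := (sqrt_pos.2 hδ.1).ne'
  have h1 : 1 - δ ≠ 0 := by linarith [hδ.2]
  have h2 : √(2 - δ) ≠ 0 := (sqrt_pos.2 (by linarith [hδ.2])).ne'
  rw [mesh, sinh_arsinh, sqrt_mul hδ.1.le, sqrt_mul zero_le_two]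
  field_simp

end Analysis

end Experts

theorem theorem5 (rank : Experts.Ranking 4) (hrank : rank.IsSorted) (A : ℝ → Experts.Player 4) :
    (∀ δ ∈ Set.Ioo (0 : ℝ) 1, Summable (Experts.geomTerm δ (Experts.comb rank) (A δ))) ∧
      Asymptotics.IsEquivalent (𝓝[>] (0 : ℝ))
        (fun δ => Experts.geomRegret δ (Experts.comb rank) (A δ))
        (fun δ => Real.pi / 4 * (1 / Real.sqrt (2 * δ))) := by
  have key : ∀ δ ∈ Set.Ioo (0 : ℝ) 1, HasSum (Experts.geomTerm δ (Experts.comb rank) (A δ))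
      ((1 + Experts.riemannTail (Experts.mesh δ) 0) / (2 * Real.sinh (Experts.mesh δ))) :=
    fun δ hδ => Experts.hasSum_geomTerm_comb_of_cosh hrank (A δ) hδ.1 hδ.2
      (Experts.mesh_pos hδ.1 hδ.2) (Experts.inv_cosh_mesh hδ.1 hδ.2)
  refine ⟨fun δ hδ => (key δ hδ).summable, Asymptotics.isEquivalent_of_tendsto_one ?_⟩
  -- The factor `2 / π` is the `1 / 2` of the regret formula divided by `π / 4`, so the product is
  -- the ratio of the two sides.
  have hlim := (((Experts.tendsto_riemannTail_zero.comp Experts.tendsto_mesh).const_add 1).mul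
    Experts.tendsto_sqrt_div_sinh_mesh).mul_const (2 / Real.pi)
  have hpi := Real.pi_ne_zero
  have e : (1 + (Real.pi / 2 - 1)) * 1 * (2 / Real.pi) = 1 := by
    field_simp
    ring
  rw [e] at hlim
  refine hlim.congr' ?_
  filter_upwards [Ioo_mem_nhdsGT (zero_lt_one' ℝ)] with δ hδ
  have hs := (Real.sinh_pos_iff.2 (Experts.mesh_pos hδ.1 hδ.2)).ne'
  have hq : √(2 * δ) ≠ 0 := (Real.sqrt_pos.2 (mul_pos two_pos hδ.1)).ne'
  rw [Pi.div_apply, Experts.geomRegret, (key δ hδ).tsum_eq]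
  simp only [Function.comp_apply]
  field_simp
  ring
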